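/- Let $(X,\mu)$ be a Lebesgue space (with $\mu$ a probability measure) and let $\varsigma=(\varsigma_n)_{n\ge 0}$ be a dyadic filtration on it: a sequence of measurable partitions of $X$ such that $\varsigma_0$ is the partition into points, every element of $\varsigma_{n+1}$ is the union of exactly two elements of $\varsigma_n$, and the conditional measures of $\mu$ on the ($2^n$-point) elements of $\varsigma_n$ are uniform. A semimetric $\rho$ on $X$ is called an admissible metric if it is measurable with respect to $\mu^2$ as a function of two variables and there is a subset of $X$ of full measure on which $\rho$ is separable and is a metric; it is called summable if $\rho\in L^1(X^2,\mu^2)$. For a semimetric $\rho$ and $n\ge 0$, define the semimetric $\mathcal K_n[\rho]$ on the set $X/\varsigma_n$ of elements of $\varsigma_n$ by $$\mathcal K_n[\rho](c_1,c_2)=\inf_{T}\frac1{2^n}\sum_{x\in c_1}\rho(x,Tx),$$ where $T$ runs over all bijections $T\colon c_1\to c_2$ that preserve the dyadic hierarchy, i.e. such that, for all $k\le n$ and $x,y\in c_1$, the points $x,y$ lie in the same element of $\varsigma_k$ if and only if $Tx,Ty$ do. For a space $Y$ with a probability measure $\nu$ and a semimetric $d$, and for $\varepsilon>0$, let $\mathbb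 H_\varepsilon(Y,\nu,d)$ be the binary logarithm of the smallest positive integer $k$ for which $Y$ can be partitioned into measurable sets $Y_0,\dots,Y_k$ with $\nu(Y_0)<\varepsilon$ and with $Y_1,\dots,Y_k$ of $d$-diameter less than $\varepsilon$ ($+\infty$ if there is no such $k$). A sequence $(h_n)_{n\ge1}$ of positive numbers is called a scaling sequence for $\rho$ and $\varsigma$ if there is $\varepsilon_0>0$ such that, for every $\varepsilon\in(0,\varepsilon_0)$, $$0<\liminf_{n\to\infty}\frac{\mathbb H_\varepsilon(X/\varsigma_n,\mu/\varsigma_n,\mathcal K_n[\rho])}{h_n}\le\limsup_{n\to\infty}\frac{\mathbb H_\varepsilon(X/\varsigma_n,\mu/\varsigma_n,\mathcal K_n[\rho])}{h_n}<\infty,$$ where $\mu/\varsigma_n$ is the quotient measure. Let $\mathcal H(X,\mu,\varsigma,\rho)$ be the class of all scaling sequences for $\rho$ and $\varsigma$. Theorem. For any two summable admissible metrics $\rho_1,\rho_2$ on $(X,\mu)$, $$\mathcal H(X,\mu,\varsigma,\rho_1)=\mathcal H(X,\mu,\varsigma,\rho_2).$$ -/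

import Mathlib

open MeasureTheory Filter
open scoped ENNReal

/-- A measure `μ` (in the theorem: a probability measure) makes `X` a Lebesgue space in Rokhlin's
sense: up to null sets and up to completion, `(X, μ)` is isomorphic to the real line with a Borel
measure. Here `φ` is the isomorphism mod 0, and "measurable" for the completed `σ`-algebras is
`NullMeasurableSet`. The `σ`-algebra of `X` itself may or may not be complete. -/
def IsLebesgueSpace {X : Type*} [MeasurableSpace X] (μ : Measure X) : Prop :=
  ∃ (φ : X → ℝ) (S : Set X), Measurable φ ∧ μ Sᶜ = 0 ∧ Set.InjOn φ S ∧
    ∀ A ⊆ S, NullMeasurableSet A μ → NullMeasurableSet (φ '' A) (μ.map φ)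

/-- Semimetrics on a set (nonnegativity follows from the three axioms). -/
structure IsSemimetric {X : Type*} (ρ : X → X → ℝ) : Prop where
  self_eq_zero : ∀ x, ρ x x = 0
  symm : ∀ x y, ρ x y = ρ y x
  triangle : ∀ x y z, ρ x z ≤ ρ x y + ρ y z

/-- The restriction of `ρ` to the set `S` is separable. -/
def IsSeparableOn {X : Type*} (ρ : X → X → ℝ) (S : Set X) : Prop :=
  ∃ D ⊆ S, D.Countable ∧ ∀ x ∈ S, ∀ ε > 0, ∃ d ∈ D, ρ x d < ε

/-- Admissible metrics on `(X, μ)`: semimetrics on `X` that are measurable with respect to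
(the completion of) `μ ⊗ μ`, and that are separable and a genuine metric on some subset
of full measure. -/
structure IsAdmissibleMetric {X : Type*} [MeasurableSpace X] (μ : Measure X)
    (ρ : X → X → ℝ) : Prop where
  isSemimetric : IsSemimetric ρ
  aemeasurable : AEMeasurable (fun p : X × X => ρ p.1 p.2) (μ.prod μ)
  exists_full : ∃ S : Set X, μ Sᶜ = 0 ∧ IsSeparableOn ρ S ∧
    ∀ x ∈ S, ∀ y ∈ S, ρ x y = 0 → x = y

/-- `ρ` is summable with respect to `μ ⊗ μ`. -/
def IsSummable {X : Type*} [MeasurableSpace X] (μ : Measure X) (ρ : X → X → ℝ) : Prop :=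
  Integrable (fun p : X × X => ρ p.1 p.2) (μ.prod μ)

/-- `Y` can be partitioned into measurable sets `A 0, …, A k` such that `A 0` has measure less
than `ε`, and every other `A j` has diameter (supremum of distances) less than `ε`. -/
def HasSmallPartition {Y : Type*} [MeasurableSpace Y] (ν : Measure Y) (d : Y → Y → ℝ)
    (ε : ℝ) (k : ℕ) : Prop :=
  ∃ A : Fin (k + 1) → Set Y,
    (∀ j, NullMeasurableSet (A j) ν) ∧
    Pairwise (fun i j => Disjoint (A i) (A j)) ∧
    (⋃ j, A j) = Set.univ ∧
    ν (A 0) < ENNReal.ofReal ε ∧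
    ∀ j, j ≠ 0 → ∃ δ < ε, ∀ x ∈ A j, ∀ y ∈ A j, d x y ≤ δ

/-- The `ε`-entropy of `(Y, ν, d)`: the binary logarithm of the smallest positive `k` for which
a partition as above exists, and `∞` if there is none. -/
noncomputable def epsEntropy {Y : Type*} [MeasurableSpace Y] (ν : Measure Y) (d : Y → Y → ℝ)
    (ε : ℝ) : ℝ≥0∞ :=
  ⨅ (k : ℕ) (_ : 1 ≤ k ∧ HasSmallPartition ν d ε k), ENNReal.ofReal (Real.logb 2 k)

/-- A measurable partition, given by its equivalence relation: there are countably many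
(completed-)measurable sets that separate exactly the points of different elements. -/
def IsMeasurablePartition {X : Type*} [MeasurableSpace X] (μ : Measure X) (r : Setoid X) : Prop :=
  ∃ B : ℕ → Set X, (∀ i, NullMeasurableSet (B i) μ) ∧
    ∀ x y, r x y ↔ ∀ i, (x ∈ B i ↔ y ∈ B i)

/-- The conditional measures of `μ` on the elements of the partition `r` are the uniform measures
on `N`-point sets: `x ↦ |A ∩ r(x)| / N` is a version of the conditional probability of `A`
with respect to `r`, for every measurable set `A`. -/
def HasUniformConditionals {X : Type*} [MeasurableSpace X] (μ : Measure X) (r : Setoid X)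
    (N : ℕ) : Prop :=
  ∀ A : Set X, NullMeasurableSet A μ →
    AEMeasurable (fun x => ((A ∩ {y | r x y}).ncard : ℝ≥0∞) / N) μ ∧
    ∀ B : Set X, NullMeasurableSet B μ → (∀ x y, r x y → x ∈ B → y ∈ B) →
      μ (A ∩ B) = ∫⁻ x in B, ((A ∩ {y | r x y}).ncard : ℝ≥0∞) / N ∂μ

/-- A dyadic filtration on `(X, μ)`: a decreasing (that is, coarsening) sequence of measurable
partitions, starting from the partition into points, such that every element of the `(n+1)`-st
partition is the union of exactly two elements of the `n`-th one, with the uniform conditional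
measures on the resulting `2 ^ n`-point sets. -/
structure DyadicFiltration {X : Type*} [MeasurableSpace X] (μ : Measure X) where
  part : ℕ → Setoid X
  part_zero : part 0 = ⊥
  measurable_part : ∀ n, IsMeasurablePartition μ (part n)
  part_succ : ∀ n x, ∃ y, ¬ part n x y ∧
    ∀ z, part (n + 1) x z ↔ (part n x z ∨ part n y z)
  uniform : ∀ n, HasUniformConditionals μ (part n) (2 ^ n)

namespace DyadicFiltration

variable {X : Type*} [MeasurableSpace X] {μ : Measure X}

/-- An element `c` of the `n`-th partition, as a subset of `X`. -/
def cell (ς : DyadicFiltration μ) {n : ℕ} (c : Quotient (ς.part n)) : Set X :=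
  {x | Quotient.mk (ς.part n) x = c}

/-- The bijections between two elements of the `n`-th partition that preserve the dyadic
hierarchy, that is, carry elements of all the previous partitions to such elements. For labellings
`x₁ⱼ`, `x₂ⱼ` of the two elements by the leaves of the binary tree of height `n` compatible with
the hierarchy, these are exactly the bijections `x₁ⱼ ↦ S x₂ⱼ` with `S` an automorphism of
the tree. -/
def HierarchyEquiv (ς : DyadicFiltration μ) {n : ℕ} (c₁ c₂ : Quotient (ς.part n)) : Type _ :=
  {e : ς.cell c₁ ≃ ς.cell c₂ // ∀ k ≤ n, ∀ x y : ς.cell c₁,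
    ς.part k (x : X) (y : X) ↔ ς.part k (e x : X) (e y : X)}

/-- The Kantorovich iteration `𝒦ₙ[ρ]`, on the set of elements of the `n`-th partition. -/
noncomputable def kantorovich (ς : DyadicFiltration μ) (n : ℕ) (ρ : X → X → ℝ)
    (c₁ c₂ : Quotient (ς.part n)) : ℝ :=
  ⨅ e : ς.HierarchyEquiv c₁ c₂, 1 / 2 ^ n * ∑ᶠ x : ς.cell c₁, ρ x (e.1 x)

/-- The quotient measure `μ / ςₙ` on the set of elements of the `n`-th partition. -/
noncomputable def quotientMeasure (ς : DyadicFiltration μ) (n : ℕ) :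
    Measure (Quotient (ς.part n)) :=
  μ.map (Quotient.mk (ς.part n))

end DyadicFiltration

/-- `a ≍ b`: `0 < lim inf aₙ/bₙ ≤ lim sup aₙ/bₙ < ∞`. -/
def SameOrder (a b : ℕ → ℝ≥0∞) : Prop :=
  0 < liminf (fun n => a n / b n) atTop ∧ limsup (fun n => a n / b n) atTop < ∞

/-- The class of scaling sequences `(hₙ)`, `n ≥ 1`, for the semimetric `ρ` and
the filtration `ς` (the value `h 0` plays no role). -/
def scalingSequences {X : Type*} [MeasurableSpace X] {μ : Measure X} (ς : DyadicFiltration μ)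
    (ρ : X → X → ℝ) : Set (ℕ → ℝ) :=
  {h | (∀ n, 1 ≤ n → 0 < h n) ∧
    ∃ ε₀ > 0, ∀ ε : ℝ, 0 < ε → ε < ε₀ →
      SameOrder (fun n => epsEntropy (ς.quotientMeasure n) (ς.kantorovich n ρ) ε)
        (fun n => ENNReal.ofReal (h n))}

/-! The two metrics are compared pointwise: for every `η` and `κ` there are a constant `C` and a
function `F ≥ 0` with integral at most `κ` such that `ρ₂ x y ≤ η + C ρ₁ x y + F x + F y`
(`IsLebesgueSpace.exists_le_add_mul_add`). Averaging along any hierarchy-preserving bijection bounds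
`𝒦ₙ[ρ₂]` by `η + C 𝒦ₙ[ρ₁]` plus the means of `F` over the two cells. Since the conditional measures
are uniform, these means have the same integral as `F`, so by Markov's inequality they are small off
a small set of cells. Nothing here depends on `n`: the `ε`-entropy for `ρ₂` is at most the
`δ`-entropy for `ρ₁`, with `δ` uniform in `n`. Used in both directions, this transfers scaling
sequences.

The pointwise bound is a Lusin-type statement. Distances to dense sequences embed almost all of `X`
into a Polish space; the image contains a Borel set of full measure because `X` is a Lebesgue space.
On a large compact part of it both metrics induce the same convergence, so the identity is uniformly
continuous from `ρ₁` to `ρ₂`. The rest is absorbed by `F`, using summability of `ρ₂`. -/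

section Semimetric

/-! ### Semimetrics, dense sequences and compactness -/

variable {X : Type*} {ρ : X → X → ℝ}

lemma IsSemimetric.nonneg (h : IsSemimetric ρ) (x y : X) : 0 ≤ ρ x y := by
  have h1 := h.triangle x y x
  rw [h.self_eq_zero, h.symm y x] at h1
  linarith

lemma IsSeparableOn.mono (h : IsSemimetric ρ) {S T : Set X} (hS : IsSeparableOn ρ S)
    (hTS : T ⊆ S) : IsSeparableOn ρ T := by
  classical
  obtain ⟨D, -, hDc, hD⟩ := hS
  -- The given dense points may lie outside `T`; each is replaced by nearby points of `T`, one for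
  -- every scale at which such a point exists.
  let P : X × ℕ → Prop := fun p => ∃ x ∈ T, ρ x p.1 < 1 / ((p.2 : ℝ) + 1)
  rcases isEmpty_or_nonempty X with hX | hX
  · exact ⟨∅, by simp, by simp, fun x => hX.elim x⟩
  choose! g hgT hg using fun (p : X × ℕ) (hp : P p) => hp
  refine ⟨g '' ((D ×ˢ Set.univ) ∩ {p | P p}), ?_, ?_, ?_⟩
  · rintro _ ⟨p, hp, rfl⟩
    exact hgT p hp.2
  · exact ((hDc.prod Set.countable_univ).mono Set.inter_subset_left).image g
  · intro x hx ε hε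
    obtain ⟨n, hn⟩ := exists_nat_one_div_lt (half_pos hε)
    obtain ⟨d, hd, hxd⟩ := hD x (hTS hx) (1 / ((n : ℝ) + 1)) (by positivity)
    have hP : P (d, n) := ⟨x, hx, hxd⟩
    refine ⟨g (d, n), ⟨(d, n), ⟨⟨hd, trivial⟩, hP⟩, rfl⟩, ?_⟩
    have h1 := hg (d, n) hP
    have h2 := h.triangle x d (g (d, n))
    rw [h.symm d] at h2
    simp only at h1
    linarith

lemma IsSeparableOn.exists_seq {T : Set X} (hT : IsSeparableOn ρ T) (hne : T.Nonempty) :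
    ∃ d : ℕ → X, (∀ i, d i ∈ T) ∧ ∀ x ∈ T, ∀ ε > 0, ∃ i, ρ x (d i) < ε := by
  obtain ⟨D, hDT, hDc, hD⟩ := hT
  obtain ⟨x, hx⟩ := hne
  obtain ⟨y, hy, -⟩ := hD x hx 1 one_pos
  obtain ⟨d, rfl⟩ := hDc.exists_eq_range ⟨y, hy⟩
  refine ⟨d, fun i => hDT ⟨i, rfl⟩, fun x hx ε hε => ?_⟩
  obtain ⟨_, ⟨i, rfl⟩, hi⟩ := hD x hx ε hε
  exact ⟨i, hi⟩

/-- Convergence of the distances to a dense sequence implies convergence. -/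
lemma IsSemimetric.tendsto_of_tendsto_dense (h : IsSemimetric ρ) {T : Set X} {d : ℕ → X}
    (hd : ∀ x ∈ T, ∀ ε > 0, ∃ i, ρ x (d i) < ε) {ι : Type*} {l : Filter ι} {u : ι → X} {x : X}
    (hx : x ∈ T) (hu : ∀ i, Tendsto (fun n => ρ (d i) (u n)) l (nhds (ρ (d i) x))) :
    Tendsto (fun n => ρ (u n) x) l (nhds 0) := by
  rw [tendsto_order]
  refine ⟨fun a ha => Eventually.of_forall fun n => ha.trans_le (h.nonneg _ _), fun ε hε => ?_⟩
  obtain ⟨i, hi⟩ := hd x hx (ε / 2) (half_pos hε)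
  have hi' : ρ (d i) x < ε / 2 := by rwa [h.symm]
  filter_upwards [(hu i).eventually_lt_const hi'] with n hn
  have := h.triangle (u n) (d i) x
  rw [h.symm (u n) (d i)] at this
  linarith

lemma IsSemimetric.eq_zero_of_dense (h : IsSemimetric ρ) {T : Set X} {d : ℕ → X}
    (hd : ∀ x ∈ T, ∀ ε > 0, ∃ i, ρ x (d i) < ε) {x y : X} (hy : y ∈ T)
    (hxy : ∀ i, ρ (d i) x = ρ (d i) y) : ρ x y = 0 := by
  have := h.tendsto_of_tendsto_dense hd (l := atTop) (u := fun _ : ℕ => x) hy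
    (fun i => by rw [hxy i]; exact tendsto_const_nhds)
  exact tendsto_nhds_unique tendsto_const_nhds this

/-- On a set whose image under the distances to dense sequences lies in a compact part of the
image of the whole space, the identity map is uniformly continuous from one semimetric to
the other. -/
lemma IsSemimetric.exists_lt_of_isCompact {ρ₁ ρ₂ : X → X → ℝ} (h₁ : IsSemimetric ρ₁)
    (h₂ : IsSemimetric ρ₂) {T : Set X} (hT : ∀ x ∈ T, ∀ y ∈ T, ρ₁ x y = 0 → x = y)
    {d₁ d₂ : ℕ → X} (hd₁ : ∀ x ∈ T, ∀ ε > 0, ∃ i, ρ₁ x (d₁ i) < ε)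
    (hd₂ : ∀ x ∈ T, ∀ ε > 0, ∃ i, ρ₂ x (d₂ i) < ε) {K : Set ((ℕ → ℝ) × (ℕ → ℝ))}
    (hK : IsCompact K)
    (hKT : K ⊆ (fun x => (fun i => ρ₁ (d₁ i) x, fun i => ρ₂ (d₂ i) x)) '' T) {η : ℝ}
    (hη : 0 < η) :
    ∃ s > 0, ∀ x y, (fun i => ρ₁ (d₁ i) x, fun i => ρ₂ (d₂ i) x) ∈ K →
      (fun i => ρ₁ (d₁ i) y, fun i => ρ₂ (d₂ i) y) ∈ K → ρ₁ x y < s → ρ₂ x y < η := by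
  set Ψ : X → (ℕ → ℝ) × (ℕ → ℝ) := fun x => (fun i => ρ₁ (d₁ i) x, fun i => ρ₂ (d₂ i) x)
  by_contra! hcon
  choose x y hx hy hlt hge using fun n : ℕ => hcon (1 / ((n : ℝ) + 1)) (by positivity)
  -- Along one ultrafilter both sequences of a counterexample converge, each to a point of `T` in
  -- both semimetrics. The limits are at `ρ₁`-distance 0, hence equal, which contradicts `ρ₂ ≥ η`.
  let 𝒰 : Ultrafilter ℕ := Filter.hyperfilter ℕ
  have h𝒰 : (𝒰 : Filter ℕ) ≤ atTop := Nat.hyperfilter_le_atTop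
  have lim (z : ℕ → X) (hz : ∀ n, Ψ (z n) ∈ K) : ∃ a ∈ T,
      Tendsto (fun n => ρ₁ (z n) a) 𝒰 (nhds 0) ∧ Tendsto (fun n => ρ₂ (z n) a) 𝒰 (nhds 0) := by
    obtain ⟨_, hK', hle⟩ := hK.ultrafilter_le_nhds (𝒰.map fun n => Ψ (z n))
      (by rw [le_principal_iff]; exact Eventually.of_forall (f := (𝒰 : Filter ℕ)) hz)
    obtain ⟨a, ha, rfl⟩ := hKT hK'
    have hle' : Tendsto (fun n => Ψ (z n)) 𝒰 (nhds (Ψ a)) := hle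
    exact ⟨a, ha,
      h₁.tendsto_of_tendsto_dense hd₁ ha (tendsto_pi_nhds.1 (hle'.fst_nhds)),
      h₂.tendsto_of_tendsto_dense hd₂ ha (tendsto_pi_nhds.1 (hle'.snd_nhds))⟩
  obtain ⟨a, ha, ha₁, ha₂⟩ := lim x hx
  obtain ⟨b, hb, hb₁, hb₂⟩ := lim y hy
  have hab : a = b := by
    refine hT a ha b hb (le_antisymm ?_ (h₁.nonneg a b))
    have h3 : Tendsto (fun n : ℕ => ρ₁ (x n) a + 1 / ((n : ℝ) + 1) + ρ₁ (y n) b) 𝒰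
        (nhds (0 + 0 + 0)) :=
      (ha₁.add (tendsto_one_div_add_atTop_nhds_zero_nat.mono_left h𝒰)).add hb₁
    rw [add_zero, add_zero] at h3
    refine ge_of_tendsto' h3 fun n => ?_
    have e1 := h₁.triangle a (x n) b
    have e2 := h₁.triangle (x n) (y n) b
    rw [h₁.symm a (x n)] at e1
    linarith [hlt n]
  subst hab
  have h4 := ha₂.add hb₂
  rw [add_zero] at h4
  refine hη.not_ge (ge_of_tendsto' h4 fun n => (hge n).trans ?_)
  have := h₂.triangle (x n) a (y n)
  rwa [h₂.symm a] at this

end Semimetric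

/-! ### Comparison of metrics on a Lebesgue space -/

/-- In a Lebesgue space, the image of a set of full measure under an injective measurable map to
a standard Borel space contains a Borel set of full measure. -/
lemma IsLebesgueSpace.exists_measurableSet_subset_image {X W : Type*} [MeasurableSpace X]
    {μ : Measure X} (hμ : IsLebesgueSpace μ) [MeasurableSpace W] [StandardBorelSpace W] {Ψ : X → W}
    (hΨ : AEMeasurable Ψ μ) {T : Set X} (hT : μ Tᶜ = 0) (hinj : Set.InjOn Ψ T) :
    ∃ R ⊆ Ψ '' T, MeasurableSet R ∧ ∀ᵐ x ∂μ, Ψ x ∈ R := by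
  obtain ⟨φ, S, hφ, hS, hφS, him⟩ := hμ
  rcases isEmpty_or_nonempty X with hX | hX
  · exact ⟨∅, by simp, MeasurableSet.empty, by simp [Subsingleton.elim μ 0]⟩
  have full (Z : Set X) (hZS : Z ⊆ S) (hZ : μ Zᶜ = 0) :
      NullMeasurableSet (φ '' Z) (μ.map φ) ∧ μ.map φ (φ '' Z)ᶜ = 0 := by
    have hn : NullMeasurableSet (φ '' Z) (μ.map φ) :=
      him Z hZS (NullMeasurableSet.of_compl (NullMeasurableSet.of_null hZ))
    refine ⟨hn, ?_⟩
    rw [Measure.map_apply₀ hφ.aemeasurable hn.compl]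
    exact measure_mono_null (fun x hx hxZ => hx ⟨x, hxZ, rfl⟩) hZ
  -- `Ψ` is transported to the line, where a Borel version of `w` is injective on a Borel set; the
  -- Lusin–Souslin theorem then makes the image Borel.
  let w : ℝ → W := fun z => Ψ (Function.invFunOn φ S z)
  have hwφ : ∀ x ∈ S, w (φ x) = Ψ x := fun x hx => by
    simp only [w, hφS.leftInvOn_invFunOn hx]
  have hw : AEMeasurable w (μ.map φ) := by
    have : Nonempty W := hX.map Ψ
    refine NullMeasurable.aemeasurable fun A hA => ?_
    have e : w ⁻¹' A =ᵐ[μ.map φ] φ '' (Ψ ⁻¹' A ∩ S) := by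
      have hfull : ∀ᵐ z ∂(μ.map φ), z ∈ φ '' S := (full S subset_rfl hS).2
      filter_upwards [hfull] with z hz
      obtain ⟨x, hx, rfl⟩ := hz
      refine propext ⟨fun h => ⟨x, ⟨?_, hx⟩, rfl⟩, ?_⟩
      · have : w (φ x) ∈ A := h
        rwa [hwφ x hx] at this
      · rintro ⟨x', ⟨hx'A, hx'S⟩, e⟩
        change w (φ x) ∈ A
        rw [← e, hwφ x' hx'S]
        exact hx'A
    exact (him _ Set.inter_subset_right ((hΨ.nullMeasurable hA).inter
      (NullMeasurableSet.of_compl (NullMeasurableSet.of_null hS)))).congr e.symm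
  have hU : ∀ᵐ x ∂μ, hw.mk w (φ x) = w (φ x) := ae_of_ae_map hφ.aemeasurable hw.ae_eq_mk.symm
  let Z : Set X := T ∩ S ∩ {x | hw.mk w (φ x) = w (φ x)}
  have hZ : ∀ᵐ x ∂μ, x ∈ Z := by
    filter_upwards [show ∀ᵐ x ∂μ, x ∈ T from hT, show ∀ᵐ x ∂μ, x ∈ S from hS, hU]
      with x h1 h2 h3 using ⟨⟨h1, h2⟩, h3⟩
  have hZU : ∀ x ∈ Z, hw.mk w (φ x) = Ψ x := fun x hx => hx.2.trans (hwφ x hx.1.2)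
  obtain ⟨hn, hc⟩ := full Z (fun x hx => hx.1.2) hZ
  obtain ⟨B, hBZ, hBm, hB⟩ := hn.exists_measurable_subset_ae_eq
  refine ⟨hw.mk w '' B, ?_, ?_, ?_⟩
  · rintro _ ⟨z, hz, rfl⟩
    obtain ⟨x, hx, rfl⟩ := hBZ hz
    exact ⟨x, hx.1.1, (hZU x hx).symm⟩
  · refine hBm.image_of_measurable_injOn hw.measurable_mk ?_
    intro z hz z' hz' e
    obtain ⟨x, hx, rfl⟩ := hBZ hz
    obtain ⟨x', hx', rfl⟩ := hBZ hz'
    rw [hZU x hx, hZU x' hx'] at e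
    rw [hinj hx.1.1 hx'.1.1 e]
  · have h1 : ∀ᵐ z ∂(μ.map φ), z ∈ B := by
      filter_upwards [show ∀ᵐ z ∂(μ.map φ), z ∈ φ '' Z from hc, hB] with z hz e
      exact e.mpr hz
    filter_upwards [ae_of_ae_map hφ.aemeasurable h1, hZ] with x hx hxZ
    exact ⟨φ x, hx, hZU x hxZ⟩

/-- The identity map is uniformly continuous from one admissible metric to another on sets of
measure arbitrarily close to `1`. -/
lemma IsLebesgueSpace.exists_unifContOn {X : Type*} [MeasurableSpace X] {μ : Measure X}
    [IsProbabilityMeasure μ] (hμ : IsLebesgueSpace μ) {ρ₁ ρ₂ : X → X → ℝ}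
    (hρ₁ : IsAdmissibleMetric μ ρ₁) (hs₁ : IsSummable μ ρ₁)
    (hρ₂ : IsAdmissibleMetric μ ρ₂) (hs₂ : IsSummable μ ρ₂) {η : ℝ} (hη : 0 < η)
    {κ : ℝ≥0∞} (hκ : κ ≠ 0) :
    ∃ K : Set X, NullMeasurableSet K μ ∧ μ Kᶜ ≤ κ ∧
      ∃ s > 0, ∀ x ∈ K, ∀ y ∈ K, ρ₁ x y < s → ρ₂ x y < η := by
  obtain ⟨S₁, hS₁, hsep₁, hsp₁⟩ := hρ₁.exists_full
  obtain ⟨S₂, hS₂, hsep₂, -⟩ := hρ₂.exists_full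
  have hg₁ : ∀ᵐ x ∂μ, Integrable (ρ₁ x) μ := Integrable.prod_right_ae hs₁
  have hg₂ : ∀ᵐ x ∂μ, Integrable (ρ₂ x) μ := Integrable.prod_right_ae hs₂
  -- Fubini makes the slices `ρ x ·` a.e.-measurable only for almost every `x`, so the dense
  -- sequences are chosen among such `x`.
  let T : Set X := {x | (x ∈ S₁ ∧ x ∈ S₂) ∧ Integrable (ρ₁ x) μ ∧ Integrable (ρ₂ x) μ}
  have hT : ∀ᵐ x ∂μ, x ∈ T := by
    filter_upwards [show ∀ᵐ x ∂μ, x ∈ S₁ from hS₁, show ∀ᵐ x ∂μ, x ∈ S₂ from hS₂, hg₁, hg₂]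
      with x h1 h2 h3 h4 using ⟨⟨h1, h2⟩, h3, h4⟩
  have hne : T.Nonempty := hT.exists
  obtain ⟨d₁, hd₁T, hd₁⟩ :=
    (hsep₁.mono hρ₁.isSemimetric (T := T) fun x hx => hx.1.1).exists_seq hne
  obtain ⟨d₂, hd₂T, hd₂⟩ :=
    (hsep₂.mono hρ₂.isSemimetric (T := T) fun x hx => hx.1.2).exists_seq hne
  have hsp : ∀ x ∈ T, ∀ y ∈ T, ρ₁ x y = 0 → x = y :=
    fun x hx y hy => hsp₁ x hx.1.1 y hy.1.1
  let Ψ : X → (ℕ → ℝ) × (ℕ → ℝ) := fun x => (fun i => ρ₁ (d₁ i) x, fun i => ρ₂ (d₂ i) x)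
  have hΨ : AEMeasurable Ψ μ :=
    (aemeasurable_pi_lambda _ fun i => (hd₁T i).2.1.aemeasurable).prodMk
      (aemeasurable_pi_lambda _ fun i => (hd₂T i).2.2.aemeasurable)
  have hinj : Set.InjOn Ψ T := fun x hx y hy e =>
    hsp x hx y hy (hρ₁.isSemimetric.eq_zero_of_dense hd₁ hy fun i =>
      congrFun (congrArg Prod.fst e) i)
  obtain ⟨R, hRT, hR, hΨR⟩ := hμ.exists_measurableSet_subset_image hΨ hT hinj
  have hprob : IsProbabilityMeasure (μ.map Ψ) := Measure.isProbabilityMeasure_map hΨ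
  have hR1 : μ.map Ψ R = 1 := by
    rw [Measure.map_apply_of_aemeasurable hΨ hR, prob_compl_eq_zero_iff₀ (hΨ.nullMeasurable hR) |>.1]
    exact hΨR
  obtain ⟨L, hLR, ⟨hL, hLc⟩, hLm⟩ := innerRegular_isCompact_isClosed_measurableSet_of_finite
    (μ.map Ψ) hR (1 - κ) (by rw [hR1]; exact ENNReal.sub_lt_self (by simp) (by simp) hκ)
  have hLn : NullMeasurableSet (Ψ ⁻¹' L) μ := hΨ.nullMeasurable hLc.measurableSet
  obtain ⟨s, hs, h⟩ := hρ₁.isSemimetric.exists_lt_of_isCompact hρ₂.isSemimetric hsp hd₁ hd₂ hL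
    (hLR.trans hRT) hη
  refine ⟨Ψ ⁻¹' L, hLn, ?_, s, hs, fun x hx y hy => h x y hx hy⟩
  rw [prob_compl_eq_one_sub₀ hLn, ← Measure.map_apply_of_aemeasurable hΨ hLc.measurableSet]
  exact tsub_le_iff_tsub_le.1 hLm.le

/-- Up to an error that is small on average, a summable admissible metric is bounded by a small
constant plus a multiple of any other one. -/
lemma IsLebesgueSpace.exists_le_add_mul_add {X : Type*} [MeasurableSpace X] {μ : Measure X}
    [IsProbabilityMeasure μ] (hμ : IsLebesgueSpace μ) {ρ₁ ρ₂ : X → X → ℝ}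
    (hρ₁ : IsAdmissibleMetric μ ρ₁) (hs₁ : IsSummable μ ρ₁)
    (hρ₂ : IsAdmissibleMetric μ ρ₂) (hs₂ : IsSummable μ ρ₂) {η : ℝ} (hη : 0 < η)
    {κ : ℝ≥0∞} (hκ : κ ≠ 0) :
    ∃ (C : ℝ) (F : X → ℝ≥0∞), 0 < C ∧ Measurable F ∧ ∫⁻ x, F x ∂μ ≤ κ ∧
      ∀ x y, ENNReal.ofReal (ρ₂ x y) ≤
        ENNReal.ofReal η + ENNReal.ofReal C * ENNReal.ofReal (ρ₁ x y) + (F x + F y) := by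
  have hg₂ : ∀ᵐ x ∂μ, Integrable (ρ₂ x) μ := Integrable.prod_right_ae hs₂
  obtain ⟨a, ha⟩ := hg₂.exists
  let b : X → ℝ := ha.aemeasurable.mk
  have hbm : Measurable b := ha.aemeasurable.measurable_mk
  have hba : ρ₂ a =ᵐ[μ] b := ha.aemeasurable.ae_eq_mk
  have hb : Integrable b μ := ha.congr hba
  have hlim : Tendsto (fun M : ℕ => ∫⁻ x, ENNReal.ofReal (b x - M) ∂μ) atTop (nhds 0) := by
    have h0 : (0 : ℝ≥0∞) = ∫⁻ _, 0 ∂μ := by simp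
    rw [h0]
    refine tendsto_lintegral_of_dominated_convergence (fun x => ENNReal.ofReal (b x))
      (fun M => (hbm.sub_const _).ennreal_ofReal)
      (fun M => Eventually.of_forall fun x => ENNReal.ofReal_le_ofReal (by simp))
      hb.lintegral_lt_top.ne ?_
    refine Eventually.of_forall fun x => tendsto_const_nhds.congr' ?_
    obtain ⟨m, hm⟩ := exists_nat_ge (b x)
    filter_upwards [eventually_ge_atTop m] with M hM
    have : (m : ℝ) ≤ M := by exact_mod_cast hM
    exact (ENNReal.ofReal_of_nonpos (by linarith)).symm
  have hκ2 : 0 < κ / 2 := ENNReal.half_pos hκ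
  obtain ⟨M, hM, hM1⟩ := ((hlim.eventually_lt_const hκ2).and (eventually_ge_atTop 1)).exists
  have hM0 : (0 : ℝ) < M := by exact_mod_cast hM1
  obtain ⟨K, hKm, hK, s, hs, hKs⟩ := hμ.exists_unifContOn hρ₁ hs₁ hρ₂ hs₂ hη
    -- Chosen so that the term `2 * M` on the hull `B` of the complement of `K` contributes at most
    -- `κ / 2` to the integral of `F`.
    (κ := κ / 2 / (2 * M)) (ENNReal.div_pos hκ2.ne' (by finiteness)).ne'
  set B : Set X := toMeasurable μ Kᶜ with hB
  set N : Set X := toMeasurable μ {x | ρ₂ a x ≠ b x} with hN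
  have hN0 : μ N = 0 := by rw [hN, measure_toMeasurable]; exact hba
  have hBm : MeasurableSet B := measurableSet_toMeasurable _ _
  have hNm : MeasurableSet N := measurableSet_toMeasurable _ _
  -- The tail of `ρ₂ a ·` above `M`, the bounded part `2 * M` off `K`, and `∞` on the null set where
  -- `b` is not `ρ₂ a ·`, so that the bound holds at every pair of points.
  let F : X → ℝ≥0∞ := fun x => ENNReal.ofReal (b x - M) + B.indicator (fun _ => (2 * M : ℝ≥0∞)) x +
    N.indicator (fun _ => ∞) x
  refine ⟨2 * M / s, F, by positivity, ?_, ?_, fun x y => ?_⟩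
  · exact (((hbm.sub_const _).ennreal_ofReal).add (measurable_const.indicator hBm)).add
      (measurable_const.indicator hNm)
  · simp only [F]
    rw [lintegral_add_right _ (measurable_const.indicator hNm),
      lintegral_add_right _ (measurable_const.indicator hBm),
      lintegral_indicator hBm, lintegral_indicator hNm, setLIntegral_const, setLIntegral_const, hN0,
      mul_zero, add_zero, ← ENNReal.add_halves κ]
    refine add_le_add hM.le ?_
    rw [hB, measure_toMeasurable]
    exact (mul_le_mul_right hK _).trans ENNReal.mul_div_le
  · have hdist : ∀ z, ENNReal.ofReal (ρ₂ a z) ≤ M + (ENNReal.ofReal (b z - M) +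
        N.indicator (fun _ => ∞) z) := fun z => by
      by_cases hz : z ∈ N
      · simp [hz]
      · have e : ρ₂ a z = b z := by
          by_contra hne
          exact hz (subset_toMeasurable _ _ hne)
        rw [e, Set.indicator_of_notMem hz, add_zero, ← ENNReal.ofReal_natCast]
        refine le_trans (ENNReal.ofReal_le_ofReal ?_) ENNReal.ofReal_add_le
        linarith
    have hxy : ENNReal.ofReal (ρ₂ x y) ≤ 2 * M + ((ENNReal.ofReal (b x - M) +
        N.indicator (fun _ => ∞) x) + (ENNReal.ofReal (b y - M) + N.indicator (fun _ => ∞) y)) := by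
      have h1 := hρ₂.isSemimetric.triangle x a y
      rw [hρ₂.isSemimetric.symm x a] at h1
      calc ENNReal.ofReal (ρ₂ x y) ≤ ENNReal.ofReal (ρ₂ a x) + ENNReal.ofReal (ρ₂ a y) :=
            (ENNReal.ofReal_le_ofReal h1).trans ENNReal.ofReal_add_le
        _ ≤ _ := add_le_add (hdist x) (hdist y)
        _ = _ := by ring
    suffices h : ENNReal.ofReal (ρ₂ x y) ≤ ENNReal.ofReal η ∨ (2 * M : ℝ≥0∞) ≤
        ENNReal.ofReal (2 * M / s) * ENNReal.ofReal (ρ₁ x y) +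
          (B.indicator (fun _ => (2 * M : ℝ≥0∞)) x + B.indicator (fun _ => (2 * M : ℝ≥0∞)) y) by
      rcases h with h | h
      · exact h.trans (by rw [add_assoc]; exact le_self_add)
      · refine hxy.trans ((add_le_add_left h _).trans ?_)
        rw [add_assoc (ENNReal.ofReal η)]
        refine le_trans (le_of_eq ?_) le_add_self
        simp only [F]
        ring
    by_cases hx : x ∈ K
    · by_cases hy : y ∈ K
      · rcases lt_or_ge (ρ₁ x y) s with hlt | hge
        · exact Or.inl (ENNReal.ofReal_le_ofReal (hKs x hx y hy hlt).le)
        · refine Or.inr (le_trans ?_ le_self_add)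
          rw [← ENNReal.ofReal_mul (by positivity), ← ENNReal.ofReal_natCast,
            ← ENNReal.ofReal_ofNat, ← ENNReal.ofReal_mul (by norm_num)]
          refine ENNReal.ofReal_le_ofReal ?_
          rw [div_mul_eq_mul_div, le_div_iff₀ hs]
          gcongr
      · refine Or.inr (le_trans ?_ le_add_self)
        rw [Set.indicator_of_mem (subset_toMeasurable _ _ hy : y ∈ B)]
        exact le_add_self
    · refine Or.inr (le_trans ?_ le_add_self)
      rw [Set.indicator_of_mem (subset_toMeasurable _ _ hx : x ∈ B)]
      exact le_self_add

/-! ### Averages over cells and measurability in the quotient -/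

section CellMean

variable {X : Type*}

/-- The sum of a function over the element of a partition that contains a given point, divided
by `N`. -/
noncomputable def cellMean (r : Setoid X) (N : ℕ) (F : X → ℝ≥0∞) (x : X) : ℝ≥0∞ :=
  (∑' y : {y | r x y}, F y) / N

variable {r : Setoid X} {N : ℕ}

lemma cellMean_eq_of_rel (F : X → ℝ≥0∞) {x y : X} (h : r x y) :
    cellMean r N F x = cellMean r N F y := by
  have : {z | r x z} = {z | r y z} :=
    Set.ext fun z => ⟨fun hz => r.trans' (r.symm' h) hz, fun hz => r.trans' h hz⟩
  rw [cellMean, cellMean, this]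

lemma cellMean_indicator (c : ℝ≥0∞) (A : Set X) {x : X} (hfin : {y | r x y}.Finite) :
    cellMean r N (A.indicator fun _ => c) x =
      c * (((A ∩ {y | r x y}).ncard : ℝ≥0∞) / N) := by
  rw [cellMean, tsum_subtype, ← mul_div_assoc]
  congr 1
  rw [Set.indicator_indicator, Set.inter_comm, ← tsum_subtype, ENNReal.tsum_set_const, mul_comm,
    ← (hfin.inter_of_right A).cast_ncard_eq]
  simp

variable [MeasurableSpace X] {μ : Measure X}

/-- For indicators this is uniformity of the conditional measures, applied to the whole space. Sums
and monotone limits follow, the latter because finite sums commute with monotone suprema. -/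
lemma HasUniformConditionals.lintegral_cellMean (hr : HasUniformConditionals μ r N)
    (hfin : ∀ x, {y | r x y}.Finite) {F : X → ℝ≥0∞} (hF : Measurable F) :
    AEMeasurable (cellMean r N F) μ ∧ ∫⁻ x, cellMean r N F x ∂μ = ∫⁻ x, F x ∂μ := by
  refine hF.ennreal_induction (motive := fun F => AEMeasurable (cellMean r N F) μ ∧
    ∫⁻ x, cellMean r N F x ∂μ = ∫⁻ x, F x ∂μ) (fun c A hA => ?_)
    (fun f g _ hf hg hf' hg' => ?_) (fun f hf hmono hf' => ?_)
  · obtain ⟨h1, h2⟩ := hr A hA.nullMeasurableSet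
    have h3 := h2 Set.univ MeasurableSet.univ.nullMeasurableSet (by simp)
    simp only [Set.inter_univ, setLIntegral_univ] at h3
    have e : cellMean r N (A.indicator fun _ => c) =
        fun x => c * (((A ∩ {y | r x y}).ncard : ℝ≥0∞) / N) :=
      funext fun x => cellMean_indicator c A (hfin x)
    rw [e]
    refine ⟨h1.const_mul c, ?_⟩
    rw [lintegral_const_mul'' c h1, ← h3, lintegral_indicator_const hA]
  · have e : cellMean r N (f + g) = fun x => cellMean r N f x + cellMean r N g x := by
      funext x
      simp only [cellMean, Pi.add_apply]
      rw [ENNReal.tsum_add, ENNReal.add_div]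
    rw [e]
    refine ⟨hf'.1.add hg'.1, ?_⟩
    rw [lintegral_add_left' hf'.1, hf'.2, hg'.2, ← lintegral_add_left hf]
    rfl
  · have e : cellMean r N (fun x => ⨆ n, f n x) = fun x => ⨆ n, cellMean r N (f n) x := by
      funext x
      have := (hfin x).fintype
      simp only [cellMean, tsum_fintype]
      rw [ENNReal.finsetSum_iSup_of_monotone (f := fun (y : {y | r x y}) n => f n y)
        fun y n m hnm => hmono hnm y, ENNReal.iSup_div]
    rw [e]
    refine ⟨AEMeasurable.iSup fun n => (hf' n).1, ?_⟩
    rw [lintegral_iSup' (fun n => (hf' n).1), lintegral_iSup hf hmono]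
    · simp only [(hf' _).2]
    · refine Eventually.of_forall fun x n m hnm => ?_
      exact ENNReal.div_le_div_right (ENNReal.tsum_le_tsum fun y : {y | r x y} => hmono hnm y) _

/-- The saturation of a null set is a null set. -/
lemma HasUniformConditionals.measure_saturation_eq_zero (hr : HasUniformConditionals μ r N)
    (hfin : ∀ x, {y | r x y}.Finite) {A : Set X} (hA : μ A = 0) :
    μ {x | ∃ y ∈ A, r x y} = 0 := by
  obtain ⟨h1, h2⟩ := hr A (NullMeasurableSet.of_null hA)
  have h3 := h2 Set.univ MeasurableSet.univ.nullMeasurableSet (by simp)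
  rw [Set.inter_univ, setLIntegral_univ, hA, eq_comm, lintegral_eq_zero_iff' h1] at h3
  refine measure_mono_null (t := {x | ¬ _}) ?_ h3
  intro x hx hx0
  obtain ⟨y, hyA, hxy⟩ := hx
  simp only [Pi.zero_apply, ENNReal.div_eq_zero_iff, Nat.cast_eq_zero, ENNReal.natCast_ne_top,
    or_false] at hx0
  replace hx0 := (Set.ncard_eq_zero ((hfin x).inter_of_right A)).1 hx0
  exact (hx0 ▸ (⟨hyA, hxy⟩ : y ∈ A ∩ {y | r x y}) : y ∈ (∅ : Set X))

/-- A measurable hull need not be saturated, nor a saturation measurable; the two operations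
alternate countably often, and the union has both properties. -/
lemma HasUniformConditionals.exists_saturated_superset (hr : HasUniformConditionals μ r N)
    (hfin : ∀ x, {y | r x y}.Finite) {A : Set X} (hA : μ A = 0) :
    ∃ B, A ⊆ B ∧ MeasurableSet B ∧ μ B = 0 ∧ ∀ x y, r x y → y ∈ B → x ∈ B := by
  let B : ℕ → Set X := fun n => Nat.rec (toMeasurable μ A)
    (fun _ C => toMeasurable μ {x | ∃ y ∈ C, r x y}) n
  have hB : ∀ n, μ (B n) = 0 := by
    intro n
    induction n with
    | zero => exact (measure_toMeasurable A).trans hA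
    | succ n ih => exact (measure_toMeasurable _).trans (hr.measure_saturation_eq_zero hfin ih)
  refine ⟨⋃ n, B n, (subset_toMeasurable μ A).trans (Set.subset_iUnion B 0),
    MeasurableSet.iUnion fun n => ?_, measure_iUnion_null hB, fun x y hxy hy => ?_⟩
  · cases n <;> exact measurableSet_toMeasurable _ _
  · obtain ⟨n, hn⟩ := Set.mem_iUnion.1 hy
    exact Set.mem_iUnion.2 ⟨n + 1, subset_toMeasurable _ _ ⟨y, hn, hxy⟩⟩

/-- A set of elements of the partition whose union is measurable is measurable with respect to
the quotient measure. -/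
lemma HasUniformConditionals.nullMeasurableSet_quotient (hr : HasUniformConditionals μ r N)
    (hfin : ∀ x, {y | r x y}.Finite) {E : Set (Quotient r)}
    (hE : NullMeasurableSet (Quotient.mk r ⁻¹' E) μ) :
    NullMeasurableSet E (μ.map (Quotient.mk r)) := by
  obtain ⟨A, hAE, hAm, hA⟩ := hE.exists_measurable_subset_ae_eq
  -- `A` need not be saturated, but removing a saturated null set that contains the defect makes it
  -- the preimage of a measurable set of cells.
  obtain ⟨B, hB, hBm, hB0, hBs⟩ := hr.exists_saturated_superset hfin (ae_le_set.1 hA.symm.le)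
  have hmk : Measurable (Quotient.mk r) := measurable_quotient_mk'
  have hpre : Quotient.mk r ⁻¹' (Quotient.mk r '' B) = B := by
    refine Set.Subset.antisymm ?_ (Set.subset_preimage_image _ _)
    rintro x ⟨y, hy, e⟩
    exact hBs x y (r.symm' (Quotient.exact e)) hy
  have hBq : MeasurableSet (Quotient.mk r '' B) := by
    rw [measurableSet_quotient]
    exact hpre.symm ▸ hBm
  have hBq0 : μ.map (Quotient.mk r) (Quotient.mk r '' B) = 0 := by
    rw [Measure.map_apply hmk hBq, hpre, hB0]
  have hdiff : MeasurableSet (E \ Quotient.mk r '' B) := by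
    rw [measurableSet_quotient]
    have : (Quotient.mk r ⁻¹' (E \ Quotient.mk r '' B)) = A \ B := by
      rw [Set.preimage_sdiff, hpre]
      refine Set.Subset.antisymm (fun x hx => ⟨?_, hx.2⟩) (Set.sdiff_subset_sdiff_left hAE)
      by_contra hxA
      exact hx.2 (hB ⟨hx.1, hxA⟩)
    exact this.symm ▸ hAm.diff hBm
  rw [← Set.sdiff_union_inter E (Quotient.mk r '' B)]
  exact hdiff.nullMeasurableSet.union
    (NullMeasurableSet.of_null (measure_mono_null Set.inter_subset_right hBq0))

end CellMean

/-! ### Kantorovich iterations under a pointwise comparison -/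

namespace DyadicFiltration

variable {X : Type*} [MeasurableSpace X] {μ : Measure X}

lemma finite_card_le (ς : DyadicFiltration μ) (n : ℕ) (x : X) :
    {y | ς.part n x y}.Finite ∧ {y | ς.part n x y}.ncard ≤ 2 ^ n := by
  induction n generalizing x with
  | zero =>
    have : {y | ς.part 0 x y} = {x} := by
      ext y
      rw [ς.part_zero]
      exact eq_comm
    simp [this]
  | succ n ih =>
    obtain ⟨y, -, hy⟩ := ς.part_succ n x
    have : {z | ς.part (n + 1) x z} = {z | ς.part n x z} ∪ {z | ς.part n y z} :=
      Set.ext fun z => hy z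
    rw [this]
    refine ⟨(ih x).1.union (ih y).1, (Set.ncard_union_le _ _).trans ?_⟩
    have h1 := (ih x).2
    have h2 := (ih y).2
    rw [pow_succ]
    omega

lemma cell_mk (ς : DyadicFiltration μ) {n : ℕ} (x : X) :
    ς.cell (Quotient.mk (ς.part n) x) = {y | ς.part n x y} :=
  Set.ext fun _ => ⟨fun h => (ς.part n).symm' (Quotient.exact h),
    fun h => Quotient.sound ((ς.part n).symm' h)⟩

/-- A pointwise comparison of semimetrics yields a comparison of their Kantorovich iterations. -/
lemma kantorovich_le (ς : DyadicFiltration μ) (n : ℕ) {ρ₁ ρ₂ : X → X → ℝ}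
    (h₁ : IsSemimetric ρ₁) (h₂ : IsSemimetric ρ₂) {η C δ θ : ℝ} (hη : 0 ≤ η) (hC : 0 ≤ C)
    (hθ : 0 ≤ θ) {F : X → ℝ≥0∞}
    (hF : ∀ x y, ENNReal.ofReal (ρ₂ x y) ≤
        ENNReal.ofReal η + ENNReal.ofReal C * ENNReal.ofReal (ρ₁ x y) + (F x + F y)) {x y : X}
    (hx : cellMean (ς.part n) (2 ^ n) F x ≤ ENNReal.ofReal θ)
    (hy : cellMean (ς.part n) (2 ^ n) F y ≤ ENNReal.ofReal θ)
    (hxy : ς.kantorovich n ρ₁ (Quotient.mk _ x) (Quotient.mk _ y) < δ) :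
    ς.kantorovich n ρ₂ (Quotient.mk _ x) (Quotient.mk _ y) ≤ η + C * δ + (θ + θ) := by
  have hfin (z : X) : Finite (ς.cell (Quotient.mk (ς.part n) z)) := by
    rw [cell_mk]
    exact (ς.finite_card_le n z).1
  have := Fintype.ofFinite (ς.cell (Quotient.mk (ς.part n) x))
  have := Fintype.ofFinite (ς.cell (Quotient.mk (ς.part n) y))
  have hnn {ρ : X → X → ℝ} (h : IsSemimetric ρ)
      (e : ς.HierarchyEquiv (Quotient.mk (ς.part n) x) (Quotient.mk (ς.part n) y)) :
      0 ≤ 1 / 2 ^ n * ∑ᶠ z : ς.cell (Quotient.mk (ς.part n) x), ρ z (e.1 z) :=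
    mul_nonneg (by positivity) (finsum_nonneg fun z => h.nonneg _ _)
  unfold kantorovich at hxy ⊢
  -- Without bijections the real infimum takes the default value 0, and the bound holds trivially;
  -- so their existence need not be proved.
  rcases isEmpty_or_nonempty
    (ς.HierarchyEquiv (Quotient.mk (ς.part n) x) (Quotient.mk (ς.part n) y)) with he | he
  · rw [Real.iInf_of_isEmpty] at hxy ⊢
    positivity
  obtain ⟨e, he⟩ := exists_lt_of_ciInf_lt hxy
  have hδ : 0 ≤ δ := (hnn h₁ e).trans he.le
  refine (ciInf_le ⟨0, by rintro _ ⟨e, rfl⟩; exact hnn h₂ e⟩ e).trans ?_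
  rw [finsum_eq_sum_of_fintype] at he ⊢
  have mean (z : X) [Fintype (ς.cell (Quotient.mk (ς.part n) z))]
      (hz : cellMean (ς.part n) (2 ^ n) F z ≤ ENNReal.ofReal θ) :
      ∑ w : ς.cell (Quotient.mk (ς.part n) z), F w ≤ ENNReal.ofReal (2 ^ n * θ) := by
    rw [cellMean, ← cell_mk, tsum_fintype, ENNReal.div_le_iff (by simp) (by simp)] at hz
    refine hz.trans (le_of_eq ?_)
    rw [mul_comm, ENNReal.ofReal_mul (by positivity), ENNReal.ofReal_pow (by norm_num)]
    simp
  have hcard : (Fintype.card (ς.cell (Quotient.mk (ς.part n) x)) : ℝ) ≤ 2 ^ n := by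
    have := (ς.finite_card_le n x).2
    rw [← cell_mk, ← Nat.card_coe_set_eq, Nat.card_eq_fintype_card] at this
    exact_mod_cast this
  have hsum : ENNReal.ofReal (∑ z : ς.cell (Quotient.mk (ς.part n) x), ρ₂ z (e.1 z)) ≤
      ENNReal.ofReal (2 ^ n * (η + C * δ + (θ + θ))) := by
    have hlt : ∑ z : ς.cell (Quotient.mk (ς.part n) x), ρ₁ z (e.1 z) ≤ 2 ^ n * δ := by
      rw [one_div, inv_mul_lt_iff₀ (by positivity)] at he
      exact he.le
    calc ENNReal.ofReal (∑ z : ς.cell (Quotient.mk (ς.part n) x), ρ₂ z (e.1 z))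
        = ∑ z : ς.cell (Quotient.mk (ς.part n) x), ENNReal.ofReal (ρ₂ z (e.1 z)) :=
          ENNReal.ofReal_sum_of_nonneg fun z _ => h₂.nonneg _ _
      _ ≤ ∑ z : ς.cell (Quotient.mk (ς.part n) x), (ENNReal.ofReal η +
            ENNReal.ofReal C * ENNReal.ofReal (ρ₁ z (e.1 z)) + (F z + F (e.1 z))) :=
          Finset.sum_le_sum fun z _ => hF _ _
      -- Reindexing by the bijection turns the second `F`-term into a sum over the other cell,
      -- independent of the bijection.
      _ = Fintype.card (ς.cell (Quotient.mk (ς.part n) x)) * ENNReal.ofReal η +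
            ENNReal.ofReal C *
              ENNReal.ofReal (∑ z : ς.cell (Quotient.mk (ς.part n) x), ρ₁ z (e.1 z)) +
            (∑ z : ς.cell (Quotient.mk (ς.part n) x), F z +
              ∑ z : ς.cell (Quotient.mk (ς.part n) y), F z) := by
          rw [Finset.sum_add_distrib, Finset.sum_add_distrib, Finset.sum_add_distrib,
            ENNReal.ofReal_sum_of_nonneg fun z _ => h₁.nonneg _ _, Finset.mul_sum,
            Equiv.sum_comp e.1 fun z => F z]
          simp
      _ ≤ ENNReal.ofReal (2 ^ n) * ENNReal.ofReal η +
            ENNReal.ofReal C * ENNReal.ofReal (2 ^ n * δ) +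
            (ENNReal.ofReal (2 ^ n * θ) + ENNReal.ofReal (2 ^ n * θ)) := by
          have := mean x hx
          have := mean y hy
          gcongr
          rw [← ENNReal.ofReal_natCast]
          exact ENNReal.ofReal_le_ofReal hcard
      _ = ENNReal.ofReal (2 ^ n * (η + C * δ + (θ + θ))) := by
          rw [← ENNReal.ofReal_mul (by positivity), ← ENNReal.ofReal_mul hC,
            ← ENNReal.ofReal_add (by positivity) (by positivity),
            ← ENNReal.ofReal_add (by positivity) (by positivity),
            ← ENNReal.ofReal_add (by positivity) (by positivity)]
          congr 1
          ring
  rw [one_div, inv_mul_le_iff₀ (by positivity)]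
  exact (ENNReal.ofReal_le_ofReal_iff (by positivity)).1 hsum

end DyadicFiltration

/-! ### Comparison of entropies and of scaling sequences -/

lemma epsEntropy_anti {Y : Type*} [MeasurableSpace Y] (ν : Measure Y) (d : Y → Y → ℝ) {ε ε' : ℝ}
    (h : ε ≤ ε') : epsEntropy ν d ε' ≤ epsEntropy ν d ε := by
  refine le_iInf₂ fun k hk => iInf₂_le k ⟨hk.1, ?_⟩
  obtain ⟨A, h1, h2, h3, h4, h5⟩ := hk.2
  refine ⟨A, h1, h2, h3, h4.trans_le (ENNReal.ofReal_le_ofReal h), fun j hj => ?_⟩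
  obtain ⟨δ, hδ, h6⟩ := h5 j hj
  exact ⟨δ, hδ.trans_le h, h6⟩

/-- If one semimetric is small wherever another one is small, outside a small set, then
its entropy is bounded by that of the other one. -/
lemma HasSmallPartition.of_le {Y : Type*} [MeasurableSpace Y] {ν : Measure Y} {d₁ d₂ : Y → Y → ℝ}
    {δ ε ε' : ℝ} {k : ℕ} (h : HasSmallPartition ν d₁ δ k) {E : Set Y}
    (hE : NullMeasurableSet E ν) (hνE : ENNReal.ofReal δ + ν E ≤ ENNReal.ofReal ε) (hε : ε' < ε)
    (hd : ∀ x ∉ E, ∀ y ∉ E, d₁ x y < δ → d₂ x y ≤ ε') (hνE' : ν E ≠ ∞) :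
    HasSmallPartition ν d₂ ε k := by
  classical
  obtain ⟨A, h1, h2, h3, h4, h5⟩ := h
  -- `E` is moved into the exceptional part, so the number `k` does not change.
  refine ⟨fun j => if j = 0 then A 0 ∪ E else A j \ E, fun j => ?_, fun i j hij => ?_, ?_, ?_,
    fun j hj => ⟨ε', hε, ?_⟩⟩
  · dsimp only
    split_ifs
    · exact (h1 0).union hE
    · exact (h1 j).diff hE
  · have hA := Set.disjoint_left.1 (h2 hij)
    refine Set.disjoint_left.2 fun x hx hx' => ?_
    dsimp only at hx hx'
    split_ifs at hx hx' with hi hj hj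
    · exact hij (hi.trans hj.symm)
    · exact hx.elim (fun hx => hA (hi ▸ hx) hx'.1) hx'.2
    · exact hx'.elim (fun hx' => hA hx.1 (hj ▸ hx')) hx.2
    · exact hA hx.1 hx'.1
  · refine Set.eq_univ_of_forall fun x => Set.mem_iUnion.2 ?_
    by_cases hx : x ∈ E
    · exact ⟨0, by simp [hx]⟩
    · obtain ⟨j, hj⟩ := Set.mem_iUnion.1 (h3.symm ▸ Set.mem_univ x : x ∈ ⋃ j, A j)
      refine ⟨j, ?_⟩
      by_cases hj0 : j = 0
      · subst hj0; simp [hj]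
      · simp [hj0, hj, hx]
  · simp only [if_true]
    exact (measure_union_le _ _).trans_lt ((ENNReal.add_lt_add_right hνE' h4).trans_le hνE)
  · intro x hx y hy
    simp only [hj, if_false] at hx hy
    obtain ⟨δ', hδ', h6⟩ := h5 j hj
    exact hd x hx.2 y hy.2 ((h6 x hx.1 y hy.1).trans_lt hδ')

/-- The entropies of the Kantorovich iterations of one summable admissible metric are bounded
by those of any other one, uniformly in the number of iterations. -/
lemma IsLebesgueSpace.exists_epsEntropy_le {X : Type*} [MeasurableSpace X] {μ : Measure X}
    [IsProbabilityMeasure μ] (hμ : IsLebesgueSpace μ) (ς : DyadicFiltration μ) {ρ₁ ρ₂ : X → X → ℝ}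
    (hρ₁ : IsAdmissibleMetric μ ρ₁) (hs₁ : IsSummable μ ρ₁)
    (hρ₂ : IsAdmissibleMetric μ ρ₂) (hs₂ : IsSummable μ ρ₂) {ε : ℝ} (hε : 0 < ε) :
    ∃ δ₀ > 0, ∀ δ ≤ δ₀, ∀ n,
      epsEntropy (ς.quotientMeasure n) (ς.kantorovich n ρ₂) ε ≤
        epsEntropy (ς.quotientMeasure n) (ς.kantorovich n ρ₁) δ := by
  -- Markov's inequality at level `ε / 8` gives a bad set of measure at most `ε / 2`; the other `ε /
  -- 2` is left for the old exceptional part. On good cells the new distance is at most `4 * (ε / 8)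
  -- < ε`.
  obtain ⟨C, F, hC, hFm, hF, h⟩ := hμ.exists_le_add_mul_add hρ₁ hs₁ hρ₂ hs₂
    (η := ε / 8) (by positivity) (κ := ENNReal.ofReal (ε / 8) * ENNReal.ofReal (ε / 2))
    (mul_ne_zero (by simpa using hε) (by simpa using hε))
  have hCδ : C * min (ε / 2) (ε / (8 * C)) ≤ ε / 8 := by
    refine (mul_le_mul_of_nonneg_left (min_le_right _ _) hC.le).trans (le_of_eq ?_)
    field_simp
  refine ⟨min (ε / 2) (ε / (8 * C)), by positivity, fun δ hδ n =>
    le_trans (le_iInf₂ fun k hk => iInf₂_le k ⟨hk.1, ?_⟩) (epsEntropy_anti _ _ hδ)⟩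
  have hfin := fun x => (ς.finite_card_le n x).1
  obtain ⟨hm, hint⟩ := (ς.uniform n).lintegral_cellMean hfin hFm
  let E : Set (Quotient (ς.part n)) := Quotient.mk (ς.part n) ''
    {x | ENNReal.ofReal (ε / 8) ≤ cellMean (ς.part n) (2 ^ n) F x}
  have hE : Quotient.mk (ς.part n) ⁻¹' E =
      {x | ENNReal.ofReal (ε / 8) ≤ cellMean (ς.part n) (2 ^ n) F x} := by
    refine Set.Subset.antisymm ?_ (Set.subset_preimage_image _ _)
    rintro x ⟨y, hy, e⟩
    exact hy.trans_eq (cellMean_eq_of_rel F (Quotient.exact e))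
  have hEn : NullMeasurableSet E (ς.quotientMeasure n) :=
    (ς.uniform n).nullMeasurableSet_quotient hfin
      (hE.symm ▸ hm.nullMeasurable measurableSet_Ici)
  have hEμ : ς.quotientMeasure n E ≤ ENNReal.ofReal (ε / 2) := by
    have hq : Measurable (Quotient.mk (ς.part n)) := measurable_quot_mk
    rw [DyadicFiltration.quotientMeasure,
      Measure.map_apply₀ hq.aemeasurable hEn, hE]
    have hmk := mul_meas_ge_le_lintegral₀ hm (ENNReal.ofReal (ε / 8))
    rw [hint] at hmk
    exact (ENNReal.mul_le_mul_iff_right (by simpa using hε) ENNReal.ofReal_ne_top).1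
      (hmk.trans hF)
  refine hk.2.of_le (ε' := ε / 8 + C * min (ε / 2) (ε / (8 * C)) + (ε / 8 + ε / 8)) hEn ?_
    (by linarith) ?_ (hEμ.trans_lt ENNReal.ofReal_lt_top).ne
  · calc _ ≤ ENNReal.ofReal (ε / 2) + ENNReal.ofReal (ε / 2) :=
          add_le_add (ENNReal.ofReal_le_ofReal (min_le_left _ _)) hEμ
      _ = _ := by rw [← ENNReal.ofReal_add (by positivity) (by positivity), add_halves]
  · intro c₁ hc₁ c₂ hc₂ hlt
    induction c₁ using Quotient.ind with | _ x
    induction c₂ using Quotient.ind with | _ y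
    have good (z : X) (hz : Quotient.mk (ς.part n) z ∉ E) :
        cellMean (ς.part n) (2 ^ n) F z ≤ ENNReal.ofReal (ε / 8) :=
      le_of_not_ge fun hle => hz ⟨z, hle, rfl⟩
    exact ς.kantorovich_le n hρ₁.isSemimetric hρ₂.isSemimetric (by positivity) hC.le
      (by positivity) h (good x hc₁) (good y hc₂) hlt

/-- The lower bound at every small `ε` comes from `ρ₁` at the single scale `ε₀ / 2`, which fixes the
new threshold `δ₁`. The upper bound comes from `ρ₁` at a scale depending on `ε`, cut off by `ε₀ / 2`
to stay in the range where `h` scales. -/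
lemma IsLebesgueSpace.scalingSequences_subset {X : Type*} [MeasurableSpace X] {μ : Measure X}
    [IsProbabilityMeasure μ] (hμ : IsLebesgueSpace μ) (ς : DyadicFiltration μ) {ρ₁ ρ₂ : X → X → ℝ}
    (hρ₁ : IsAdmissibleMetric μ ρ₁) (hs₁ : IsSummable μ ρ₁)
    (hρ₂ : IsAdmissibleMetric μ ρ₂) (hs₂ : IsSummable μ ρ₂) :
    scalingSequences ς ρ₁ ⊆ scalingSequences ς ρ₂ := by
  rintro h ⟨hpos, ε₀, hε₀, hh⟩
  obtain ⟨δ₁, hδ₁, hle₁⟩ := hμ.exists_epsEntropy_le ς hρ₂ hs₂ hρ₁ hs₁ (half_pos hε₀)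
  refine ⟨hpos, δ₁, hδ₁, fun ε hε hεδ => ⟨?_, ?_⟩⟩
  · refine (hh (ε₀ / 2) (half_pos hε₀) (half_lt_self hε₀)).1.trans_le (liminf_le_liminf ?_)
    exact Eventually.of_forall fun n => ENNReal.div_le_div_right (hle₁ ε hεδ.le n) _
  · obtain ⟨δ₂, hδ₂, hle₂⟩ := hμ.exists_epsEntropy_le ς hρ₁ hs₁ hρ₂ hs₂ hε
    refine lt_of_le_of_lt (limsup_le_limsup ?_)
      (hh (min δ₂ (ε₀ / 2)) (lt_min hδ₂ (half_pos hε₀))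
        ((min_le_right _ _).trans_lt (half_lt_self hε₀))).2
    exact Eventually.of_forall fun n => ENNReal.div_le_div_right (hle₂ _ (min_le_left _ _) n) _

theorem theorem8 {X : Type*} [MeasurableSpace X] (μ : Measure X) [IsProbabilityMeasure μ]
    (hμ : IsLebesgueSpace μ) (ς : DyadicFiltration μ) (ρ₁ ρ₂ : X → X → ℝ)
    (hρ₁ : IsAdmissibleMetric μ ρ₁) (hs₁ : IsSummable μ ρ₁)
    (hρ₂ : IsAdmissibleMetric μ ρ₂) (hs₂ : IsSummable μ ρ₂) :
    scalingSequences ς ρ₁ = scalingSequences ς ρ₂ :=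
  (hμ.scalingSequences_subset ς hρ₁ hs₁ hρ₂ hs₂).antisymm
    (hμ.scalingSequences_subset ς hρ₂ hs₂ hρ₁ hs₁)
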